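/- Let $d\ge 1$, let $B(x,r)\subset\mathbb{R}^d$ be the closed ball with centre $x$ and radius $r$, and let $\omega_d$ be the Lebesgue measure of $B(0,1)$. The medial axis $\mathrm{Ma}(\mathcal{M})$ of a set $\mathcal{M}\subset\mathbb{R}^d$ is the set of points of $\mathbb{R}^d$ having more than one nearest point in $\mathcal{M}$, and $\mathrm{reach}(\mathcal{M})=\inf_{x\in\mathcal{M}}\inf_{y\in\mathrm{Ma}(\mathcal{M})}\|x-y\|\in[0,\infty]$ (with $\inf\emptyset=\infty$). Random vectors $X_1,\dots,X_n$ in $\mathbb{R}^d$ are $\mathcal{AI}(\alpha)$ if they have marginal densities $f_{X_1},\dots,f_{X_n}$ and a joint density $f_{(X_1,\dots,X_n)}$ such that, for almost every $x=(x_1,\dots,x_n)$, $$\bigl|f_{(X_1,\dots,X_n)}(x)-f_{X_1}(x_1)\cdots f_{X_n}(x_n)\bigr|\le\alpha\, f_{X_1}(x_1)\cdots f_{X_n}(x_n).$$ Given $r>0$ and points $X_1,\dots,X_n$, put $\hat S_n(r)=\bigcup_{i=1}^nB(X_i,r)$. The ball $B(X_i,r)$ is a boundary ball of $\hat S_n(r)$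 if $\partial B(X_i,r)\cap\partial\hat S_n(r)\neq\emptyset$. **Theorem.** Let $\mathcal{M}\subset\mathbb{R}^d$ be compact with $\mathrm{reach}(\mathcal{M})=R_0\in(0,\infty]$, let $0<R_1<R_0$, and let $\mathcal{S}=\{x:\mathrm{dist}(x,\mathcal{M})\le R_1\}$. Let $f$ be a probability density on $\mathbb{R}^d$ whose distribution has support $\mathcal{S}$ and which satisfies $f\ge f_0$ on $\mathcal{S}$ for some constant $f_0>0$. For every $n\ge1$ let $\mathcal{X}_n=\{X_{n,1},\dots,X_{n,n}\}$ be random vectors, all defined on one probability space and each with density $f$, that are $\mathcal{AI}(\alpha_n)$ (for instance, the first $n$ terms of one sequence $X_1,X_2,\dots$), where $$\sum_{n=2}^{\infty}\frac{\alpha_n}{n^{\beta}\log n}<\infty\qquad\text{for every }\beta>1.$$ Let $\rho_n=c\left(\frac{\log n}{n}\right)^{1/d}$ with $c>\left(\frac{6}{f_0\omega_d}\right)^{1/d}$, and let $$\hat R_n=\max_{1\le i\le n}\ \min_{j\in I_{bb}}\|X_{n,i}-X_{n,j}\|,\qquad I_{bb}=\{j: B(X_{n,j},\rho_n)\text{ is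 a boundary ball of }\hat S_n(\rho_n)\}.$$ 1. If $\mathring{\mathcal{M}}=\emptyset$, then, with probability one, $|\hat R_n-R_1|\le2\rho_n$ for all $n$ large enough. 2. If $\mathring{\mathcal{M}}\ne\emptyset$, then there exists $C>0$ such that, with probability one, $|\hat R_n-R_1|>C$ for all $n$ large enough. -/

import Mathlib

open MeasureTheory ProbabilityTheory Filter Topology
open scoped ENNReal

noncomputable section

/-- The orthogonal projections of `x` onto `M`: the points of `M` nearest to `x`. -/
def orthProjections {d : ℕ} (M : Set (EuclideanSpace ℝ (Fin d)))
    (x : EuclideanSpace ℝ (Fin d)) : Set (EuclideanSpace ℝ (Fin d)) :=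
  {p | p ∈ M ∧ dist x p = Metric.infDist x M}

/-- The medial axis of `M`: the points with more than one orthogonal projection onto `M`. -/
def medialAxis {d : ℕ} (M : Set (EuclideanSpace ℝ (Fin d))) : Set (EuclideanSpace ℝ (Fin d)) :=
  {x | ∃ p ∈ orthProjections M x, ∃ q ∈ orthProjections M x, p ≠ q}

/-- The local reach of `M` at `x`; it is `∞` if the medial axis is empty. -/
def reachAt {d : ℕ} (M : Set (EuclideanSpace ℝ (Fin d))) (x : EuclideanSpace ℝ (Fin d)) : ℝ≥0∞ :=
  ⨅ y ∈ medialAxis M, edist x y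

/-- The reach of `M`; it is `∞` if the medial axis is empty (for instance if `M` is convex). -/
def reach {d : ℕ} (M : Set (EuclideanSpace ℝ (Fin d))) : ℝ≥0∞ :=
  ⨅ x ∈ M, reachAt M x

/-- `α`-almost independence of the random vectors `X 0, …, X (n - 1)`: each of them and the joint
vector have densities with respect to Lebesgue measure, and the joint density differs from the
product of the marginal densities by at most `α` times that product. Densities being defined up to
null sets, the inequality is required almost everywhere; it is written without the quotient, so that
it also makes sense where the product of the marginal densities vanishes (there it says that the
joint density vanishes, which holds almost everywhere anyway). -/
def IsAlmostIndependent {d n : ℕ} {Ω : Type*} [MeasurableSpace Ω]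
    (X : Fin n → Ω → EuclideanSpace ℝ (Fin d)) (P : Measure Ω) (α : ℝ) : Prop :=
  (∀ i, HasPDF (X i) P volume) ∧
  HasPDF (fun ω i => X i ω) P volume ∧
  ∀ᵐ x : Fin n → EuclideanSpace ℝ (Fin d),
    |(pdf (fun ω i => X i ω) P volume x).toReal - ∏ i, (pdf (X i) P volume (x i)).toReal| ≤
      α * ∏ i, (pdf (X i) P volume (x i)).toReal

/-- The Devroye-Wise estimator: the union of the closed balls of radius `r` about the points. -/
def devroyeWise {d n : ℕ} (x : Fin n → EuclideanSpace ℝ (Fin d)) (r : ℝ) :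
    Set (EuclideanSpace ℝ (Fin d)) :=
  ⋃ i, Metric.closedBall (x i) r

/-- The `i`-th ball is a boundary ball of the Devroye-Wise estimator: its boundary meets the
boundary of the estimator. -/
def IsBoundaryBall {d n : ℕ} (x : Fin n → EuclideanSpace ℝ (Fin d)) (r : ℝ) (i : Fin n) : Prop :=
  ∃ y ∈ frontier (Metric.closedBall (x i) r), y ∈ frontier (devroyeWise x r)

/-- The maximum over all points `x i` of the minimal distance from `x i` to a centre of a boundary
ball. Both index types are finite, so `⨆` and `⨅` are a maximum and a minimum; they are non-empty as
soon as `0 < d`, `0 < n` and `0 ≤ r`, since a non-empty compact subset of `ℝ^d` has a boundary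
point. -/
def maxMinBoundaryDist {d n : ℕ} (x : Fin n → EuclideanSpace ℝ (Fin d)) (r : ℝ) : ℝ :=
  ⨆ i : Fin n, ⨅ j : {j : Fin n // IsBoundaryBall x r j}, dist (x i) (x j)

/-- The radius `c (log n / n)^(1/d)`. -/
def ballRadius (d : ℕ) (c : ℝ) (n : ℕ) : ℝ :=
  c * (Real.log n / n) ^ (1 / (d : ℝ))

/-- The Lebesgue measure of the unit ball of `ℝ^d`. -/
def unitBallVolume (d : ℕ) : ℝ :=
  volume.real (Metric.closedBall (0 : EuclideanSpace ℝ (Fin d)) 1)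

end

/-! Probability enters only through a covering statement: almost surely, for large `n`, every point
of the support `S` lies strictly within `ρ_n` of a sample point (`exists_ae_eventually_net`). It is
a union bound over a net of `S` with `O(n / log n)` points. A ball of radius almost `ρ_n` about a
net point has mass at least `γ log n / n` with `γ > 2`, so almost independence bounds the chance of
missing it by `(1 + α_n) n^(-γ)`; the total is summable by the hypothesis on `α` with `β = γ - 1`,
and Borel-Cantelli applies.

The rest is deterministic. Covering puts `S` in the interior of the estimator, so frontier points
lie outside `S` and centres of boundary balls are farther than `R₁ - ρ_n` from `M`
(`IsBoundaryBall.lt_infDist`). A sample point near `M` then gives the lower bound `R₁ - 2ρ_n`; near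
the centre of a ball of radius `η` inside `M` it gains a further `η`, which proves the second claim.

For the upper bound, below the reach the distance to `M` has no obstruction to growing at unit speed
off `M`. A point off `M` can therefore be moved just beyond distance `R₁ + ρ_n` from `M`, hence out
of the estimator, by a displacement of about that length at most. The segment crosses the frontier,
and a boundary centre lies `ρ_n` from the crossing (`exists_isBoundaryBall_dist_le_of_notMem`). If
`M` has empty interior, points of `M` are limits of points off `M`. -/

/-! ### Product integrals and almost independent samples. -/

theorem lintegral_fin_prod_eq_pow {E : Type*} [MeasureSpace E] [SigmaFinite (volume : Measure E)]
    {F : E → ℝ≥0∞} (hF : Measurable F) (n : ℕ) :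
    ∫⁻ x : Fin n → E, ∏ i, F (x i) = (∫⁻ y, F y) ^ n := by
  induction n with
  | zero => simp [volume_pi]
  | succ n ih =>
    have h := (volume_preserving_piFinSuccAbove (fun _ : Fin (n + 1) => E) 0).symm
    rw [← h.lintegral_comp (by fun_prop)]
    simp_rw [Fin.prod_univ_succ]
    simp only [MeasurableEquiv.piFinSuccAbove_symm_apply, Fin.insertNthEquiv,
      Fin.insertNth_zero, Equiv.coe_fn_mk, Fin.cons_zero, Fin.cons_succ, cast_eq]
    rw [Measure.volume_eq_prod, lintegral_prod_mul (f := F)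
      (g := fun y : Fin n → E => ∏ i, F (y i)) hF.aemeasurable
      (Finset.measurable_prod _ fun i _ => by fun_prop).aemeasurable, ih, pow_succ']

section AlmostIndependent

variable {d n : ℕ} {Ω : Type*} [MeasurableSpace Ω] {P : Measure Ω} [IsProbabilityMeasure P]
  {f : EuclideanSpace ℝ (Fin d) → ℝ} {X : Fin n → Ω → EuclideanSpace ℝ (Fin d)} {α : ℝ}

theorem pdf_ae_eq_of_hasLaw_withDensity {Y : Ω → EuclideanSpace ℝ (Fin d)} (hf : Measurable f)
    (hY : HasPDF Y P volume)
    (hlaw : HasLaw Y (volume.withDensity fun x => ENNReal.ofReal (f x)) P) :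
    pdf Y P volume =ᵐ[volume] fun x => ENNReal.ofReal (f x) :=
  (pdf.eq_of_map_eq_withDensity _ hf.ennreal_ofReal.aemeasurable).1 hlaw.map_eq

theorem ae_forall_pdf_toReal_eq (hf : Measurable f) (hf_nonneg : ∀ x, 0 ≤ f x)
    (hX : ∀ i, HasPDF (X i) P volume)
    (hlaw : ∀ i, HasLaw (X i) (volume.withDensity fun x => ENNReal.ofReal (f x)) P) :
    ∀ᵐ x : Fin n → EuclideanSpace ℝ (Fin d), ∀ i, (pdf (X i) P volume (x i)).toReal = f (x i) := by
  rw [ae_all_iff]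
  intro i
  have h := pdf_ae_eq_of_hasLaw_withDensity hf (hX i) (hlaw i)
  filter_upwards [(Measure.quasiMeasurePreserving_eval
    (fun _ : Fin n => (volume : Measure (EuclideanSpace ℝ (Fin d)))) i).ae h] with x hx
  simp [show pdf (X i) P volume (x i) = _ from hx, ENNReal.toReal_ofReal (hf_nonneg _)]

theorem IsAlmostIndependent.ae_pdf_le (hAI : IsAlmostIndependent X P α)
    (hf : Measurable f) (hf_nonneg : ∀ x, 0 ≤ f x)
    (hlaw : ∀ i, HasLaw (X i) (volume.withDensity fun x => ENNReal.ofReal (f x)) P) :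
    ∀ᵐ x : Fin n → EuclideanSpace ℝ (Fin d), pdf (fun ω i => X i ω) P volume x ≤
      ENNReal.ofReal (1 + α) * ∏ i, ENNReal.ofReal (f (x i)) := by
  have hfin : ∀ᵐ x : Fin n → EuclideanSpace ℝ (Fin d), pdf (fun ω i => X i ω) P volume x < ∞ :=
    pdf.ae_lt_top
  filter_upwards [hAI.2.2, ae_forall_pdf_toReal_eq hf hf_nonneg hAI.1 hlaw, hfin] with x h1 h2 h3
  simp only [h2] at h1
  have hp : 0 ≤ ∏ i, f (x i) := Finset.prod_nonneg fun i _ => hf_nonneg _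
  rw [← ENNReal.ofReal_prod_of_nonneg (fun i _ => hf_nonneg _), ← ENNReal.ofReal_mul' hp,
    ← ENNReal.ofReal_toReal h3.ne]
  exact ENNReal.ofReal_le_ofReal (by linarith only [(abs_le.1 h1).2])

theorem isProbabilityMeasure_of_hasLaw {E : Type*} [MeasurableSpace E] {μ : Measure E}
    {Y : Ω → E} (h : HasLaw Y μ P) : IsProbabilityMeasure μ := by
  rw [← h.map_eq]
  exact Measure.isProbabilityMeasure_map h.aemeasurable

/-- Only the upper half of almost independence matters: the joint density is at most `1 + α` times
the product density, whose integral over a cube `A^n` factorises. -/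
theorem IsAlmostIndependent.measure_forall_mem_le (hAI : IsAlmostIndependent X P α)
    (hf : Measurable f) (hf_nonneg : ∀ x, 0 ≤ f x)
    (hlaw : ∀ i, HasLaw (X i) (volume.withDensity fun x => ENNReal.ofReal (f x)) P)
    {A : Set (EuclideanSpace ℝ (Fin d))} (hA : MeasurableSet A) :
    P {ω | ∀ i, X i ω ∈ A} ≤
      ENNReal.ofReal (1 + α) * ((volume.withDensity fun x => ENNReal.ofReal (f x)) A) ^ n := by
  have hPDF := hAI.2.1
  have hs : MeasurableSet {x : Fin n → EuclideanSpace ℝ (Fin d) | ∀ i, x i ∈ A} := by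
    simp only [Set.ofPred_forall]
    exact MeasurableSet.iInter fun i => (measurable_pi_apply i) hA
  have h1 : P {ω | ∀ i, X i ω ∈ A} = P.map (fun ω i => X i ω) {x | ∀ i, x i ∈ A} := by
    rw [Measure.map_apply_of_aemeasurable hPDF.aemeasurable' hs]; rfl
  rw [h1, map_eq_setLIntegral_pdf _ P volume hs, ← lintegral_indicator hs,
    withDensity_apply _ hA, ← lintegral_indicator hA, ← lintegral_fin_prod_eq_pow
      (hf.ennreal_ofReal.indicator hA), ← lintegral_const_mul' _ _ ENNReal.ofReal_ne_top]
  refine lintegral_mono_ae ?_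
  filter_upwards [hAI.ae_pdf_le hf hf_nonneg hlaw] with x hx
  by_cases h : x ∈ {x : Fin n → EuclideanSpace ℝ (Fin d) | ∀ i, x i ∈ A}
  · rw [Set.indicator_of_mem h]
    simpa [Set.indicator_of_mem (h _)] using hx
  · simp [Set.indicator_of_notMem h]

theorem IsAlmostIndependent.nonneg (hAI : IsAlmostIndependent X P α)
    (hf : Measurable f) (hf_nonneg : ∀ x, 0 ≤ f x)
    (hlaw : ∀ i, HasLaw (X i) (volume.withDensity fun x => ENNReal.ofReal (f x)) P) :
    0 ≤ α := by
  -- With `A` the whole space both probabilities are `1`, which leaves `1 ≤ 1 + α`.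
  have h := hAI.measure_forall_mem_le hf hf_nonneg hlaw MeasurableSet.univ
  by_contra hα
  rcases Nat.eq_zero_or_pos n with rfl | hn
  · simp at h
    linarith
  have := isProbabilityMeasure_of_hasLaw (hlaw ⟨0, hn⟩)
  simp at h
  linarith

end AlmostIndependent

/-! ### Volume bounds: mass of small balls in `S`, and nets. -/

section Volume

variable {d : ℕ}

theorem unitBallVolume_pos (d : ℕ) : 0 < unitBallVolume d :=
  ENNReal.toReal_pos (Metric.measure_closedBall_pos _ _ one_pos).ne' measure_closedBall_lt_top.ne

theorem unitBallVolume_half_le (e : EuclideanSpace ℝ (Fin d)) :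
    unitBallVolume d / 2 ≤ volume.real
      {w ∈ Metric.closedBall (0 : EuclideanSpace ℝ (Fin d)) 1 | 0 ≤ inner ℝ e w} := by
  set H := {w ∈ Metric.closedBall (0 : EuclideanSpace ℝ (Fin d)) 1 | 0 ≤ inner ℝ e w} with hH
  have hfin : volume H ≠ ∞ := measure_ne_top_of_subset (Set.sep_subset _ _)
    measure_closedBall_lt_top.ne
  have hneg : volume (-H) = volume H := Measure.measure_neg _ _
  have hsub : Metric.closedBall (0 : EuclideanSpace ℝ (Fin d)) 1 ⊆ H ∪ -H := by
    intro w hw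
    rcases le_total 0 (inner ℝ e w) with h | h
    · exact Or.inl ⟨hw, h⟩
    · refine Or.inr ⟨by simpa using hw, ?_⟩
      simpa [inner_neg_right] using h
  have h1 := measureReal_mono hsub
    (measure_union_lt_top hfin.lt_top (hneg ▸ hfin.lt_top)).ne
  have h2 := measureReal_union_le (μ := volume) H (-H)
  have h3 : volume.real (-H) = volume.real H := by simp [Measure.real, hneg]
  unfold unitBallVolume
  linarith

/-- With `η = r / (2s)`, the map sends `w` to `x + r u`, `u = (1 - η) w + η e`. Then `‖u‖ ≤ 1` and
`⟨e, u⟩ ≥ η`, so `‖r u - s e‖² ≤ r² - 2 r s η + s² = s²`. A half ball shrunk by the factor `1 - η`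
thus fits where two balls meet, the second having `x` on its boundary. -/
theorem halfBall_image_subset {e x : EuclideanSpace ℝ (Fin d)} (he : ‖e‖ = 1) {r s : ℝ}
    (hr : 0 ≤ r) (hs : 0 < s) (hrs : r ≤ 2 * s) :
    (fun w => (x + (r * (r / (2 * s))) • e) + (r * (1 - r / (2 * s))) • w) ''
      {w ∈ Metric.closedBall (0 : EuclideanSpace ℝ (Fin d)) 1 | 0 ≤ inner ℝ e w} ⊆
      Metric.closedBall x r ∩ Metric.closedBall (x + s • e) s := by
  rintro _ ⟨w, ⟨hw, hew⟩, rfl⟩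
  rw [mem_closedBall_zero_iff] at hw
  set η := r / (2 * s) with hη
  have hη0 : 0 ≤ η := by positivity
  have hη1 : η ≤ 1 := (div_le_one (by positivity)).2 hrs
  have hsη : 2 * s * η = r := by rw [hη]; field_simp
  set u := (1 - η) • w + η • e with hu
  have hu1 : ‖u‖ ≤ 1 := by
    calc ‖u‖ ≤ ‖(1 - η) • w‖ + ‖η • e‖ := norm_add_le _ _
      _ = (1 - η) * ‖w‖ + η := by
        rw [norm_smul, norm_smul, he, Real.norm_of_nonneg hη0, Real.norm_of_nonneg (by linarith),
          mul_one]
      _ ≤ 1 := by nlinarith [norm_nonneg w]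
  have heu : η ≤ inner ℝ e u := by
    rw [hu, inner_add_right, inner_smul_right, inner_smul_right, real_inner_self_eq_norm_sq, he]
    nlinarith
  have hx : (x + (r * η) • e) + (r * (1 - η)) • w = x + r • u := by
    rw [hu]; module
  simp only [hx]
  constructor
  · rw [mem_closedBall_iff_norm, add_sub_cancel_left, norm_smul, Real.norm_of_nonneg hr]
    nlinarith [norm_nonneg u]
  · rw [mem_closedBall_iff_norm, show x + r • u - (x + s • e) = r • u - s • e by abel]
    refine abs_le_of_sq_le_sq' ?_ hs.le |>.2
    rw [norm_sub_sq_real, norm_smul, norm_smul, he, inner_smul_left, inner_smul_right,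
      Real.norm_of_nonneg hr, Real.norm_of_nonneg hs.le, real_inner_comm]
    simp only [conj_trivial]
    have h1 : r * s * η ≤ r * s * inner ℝ e u := by gcongr
    have h2 : (r * ‖u‖) ^ 2 ≤ r ^ 2 := by
      apply pow_le_pow_left₀ (by positivity)
      nlinarith [norm_nonneg u]
    have h3 : r * (2 * s * η) = r * r := by rw [hsη]
    nlinarith

theorem exists_tangent_closedBall_subset (hd : 0 < d) {m x : EuclideanSpace ℝ (Fin d)} {R : ℝ}
    (hx : x ∈ Metric.closedBall m R) :
    ∃ e : EuclideanSpace ℝ (Fin d), ‖e‖ = 1 ∧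
      Metric.closedBall (x + (R / 2) • e) (R / 2) ⊆ Metric.closedBall m R := by
  have : Nonempty (Fin d) := ⟨⟨0, hd⟩⟩
  have key : ∃ e : EuclideanSpace ℝ (Fin d), ‖e‖ = 1 ∧ m - x = ‖m - x‖ • e := by
    by_cases h : m - x = 0
    · obtain ⟨e, he⟩ := exists_norm_eq (EuclideanSpace ℝ (Fin d)) zero_le_one
      exact ⟨e, he, by simp [h]⟩
    · refine ⟨‖m - x‖⁻¹ • (m - x), norm_smul_inv_norm h, ?_⟩
      rw [smul_inv_smul₀ (norm_ne_zero_iff.2 h)]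
  obtain ⟨e, he, hme⟩ := key
  -- Since `e` points from `x` to `m`, the new centre is at distance `|R/2 - ‖m - x‖| ≤ R/2` from
  -- `m`.
  refine ⟨e, he, Metric.closedBall_subset_closedBall' ?_⟩
  have hxm : ‖m - x‖ ≤ R := by rwa [← dist_eq_norm, dist_comm]
  rw [dist_eq_norm, show x + (R / 2) • e - m = (R / 2) • e - (m - x) by abel, hme, ← sub_smul,
    norm_smul, he, mul_one, Real.norm_eq_abs]
  have : |R / 2 - ‖m - x‖| ≤ R / 2 := abs_le.2 ⟨by linarith, by linarith [norm_nonneg (m - x)]⟩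
  linarith

theorem volume_closedBall_inter_closedBall_ge (hd : 0 < d) {m x : EuclideanSpace ℝ (Fin d)}
    {r R : ℝ} (hr : 0 ≤ r) (hR : 0 < R) (hrR : r ≤ R) (hx : x ∈ Metric.closedBall m R) :
    unitBallVolume d / 2 * (r * (1 - r / R)) ^ d ≤
      volume.real (Metric.closedBall x r ∩ Metric.closedBall m R) := by
  obtain ⟨e, he, hsub⟩ := exists_tangent_closedBall_subset hd hx
  have h := halfBall_image_subset (x := x) he hr (half_pos hR) (by linarith)
  rw [mul_div_cancel₀ R two_ne_zero] at h
  have h0 : 0 ≤ 1 - r / R := sub_nonneg.2 ((div_le_one hR).2 hrR)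
  refine le_trans ?_ (measureReal_mono (h.trans (Set.inter_subset_inter_right _ hsub))
    (measure_ne_top_of_subset Set.inter_subset_left measure_closedBall_lt_top.ne))
  set H := {w ∈ Metric.closedBall (0 : EuclideanSpace ℝ (Fin d)) 1 | 0 ≤ inner ℝ e w}
  set b := r * (1 - r / R)
  have himg : (fun w => (x + (r * (r / R)) • e) + b • w) '' H =
      (fun w => (x + (r * (r / R)) • e) + w) '' ((fun w => b • w) '' H) := by
    rw [Set.image_image]
  rw [himg, Measure.real, Set.image_add_left, measure_preimage_add, Set.image_smul,
    Measure.addHaar_smul, finrank_euclideanSpace_fin, ENNReal.toReal_mul,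
    ENNReal.toReal_ofReal (abs_nonneg _), abs_of_nonneg (by positivity), mul_comm]
  gcongr
  exact unitBallVolume_half_le e

/-- By compactness of `M`, the thickening is a union of balls of radius `R` about points of `M`, so
each of its points sees about half of a small ball inside it. -/
theorem ofReal_mul_le_withDensity_closedBall (hd : 0 < d) {M : Set (EuclideanSpace ℝ (Fin d))}
    (hM : IsCompact M) {R : ℝ} (hR : 0 < R) {f : EuclideanSpace ℝ (Fin d) → ℝ} {f₀ : ℝ}
    (hf₀ : 0 ≤ f₀)
    (hf_lower : ∀ x ∈ Metric.cthickening R M, f₀ ≤ f x) {r : ℝ} (hr : 0 ≤ r) (hrR : r ≤ R)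
    {x : EuclideanSpace ℝ (Fin d)} (hx : x ∈ Metric.cthickening R M) :
    ENNReal.ofReal (f₀ * (unitBallVolume d / 2 * (r * (1 - r / R)) ^ d)) ≤
      (volume.withDensity fun x => ENNReal.ofReal (f x)) (Metric.closedBall x r) := by
  rw [hM.cthickening_eq_biUnion_closedBall hR.le] at hx
  obtain ⟨m, hm, hxm⟩ := Set.mem_iUnion₂.1 hx
  set A := Metric.closedBall x r ∩ Metric.closedBall m R
  have hA : MeasurableSet A := measurableSet_closedBall.inter measurableSet_closedBall
  have hAS : ∀ y ∈ A, y ∈ Metric.cthickening R M := fun y hy =>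
    Metric.closedBall_subset_cthickening hm R hy.2
  have hAfin : volume A ≠ ∞ :=
    measure_ne_top_of_subset Set.inter_subset_left measure_closedBall_lt_top.ne
  calc ENNReal.ofReal (f₀ * (unitBallVolume d / 2 * (r * (1 - r / R)) ^ d))
      ≤ ENNReal.ofReal (f₀ * volume.real A) := by
        gcongr
        exact volume_closedBall_inter_closedBall_ge hd hr hR hrR hxm
    _ = ∫⁻ _ in A, ENNReal.ofReal f₀ := by
        rw [setLIntegral_const, ENNReal.ofReal_mul hf₀, ofReal_measureReal hAfin]
    _ ≤ ∫⁻ y in A, ENNReal.ofReal (f y) :=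
        setLIntegral_mono' hA fun y hy => ENNReal.ofReal_le_ofReal (hf_lower y (hAS y hy))
    _ = (volume.withDensity fun x => ENNReal.ofReal (f x)) A := (withDensity_apply _ hA).symm
    _ ≤ _ := measure_mono Set.inter_subset_left

theorem card_mul_pow_le_of_separated {L δ : ℝ} (hδ : 0 < δ) (hδ1 : δ ≤ 1)
    {T : Finset (EuclideanSpace ℝ (Fin d))} (hT : ∀ x ∈ T, ‖x‖ ≤ L)
    (hsep : ∀ x ∈ T, ∀ y ∈ T, x ≠ y → δ < dist x y) :
    (T.card : ℝ) * (δ / 2) ^ d ≤ (|L| + 1) ^ d := by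
  have hvol : ∀ (x : EuclideanSpace ℝ (Fin d)) (s : ℝ), 0 ≤ s →
      volume.real (Metric.closedBall x s) = s ^ d * unitBallVolume d := by
    intro x s hs
    rw [Measure.real, Measure.addHaar_closedBall' _ _ hs, ENNReal.toReal_mul,
      finrank_euclideanSpace_fin, ENNReal.toReal_ofReal (by positivity)]
    rfl
  have hsub : (⋃ x ∈ T, Metric.closedBall x (δ / 2)) ⊆
      Metric.closedBall (0 : EuclideanSpace ℝ (Fin d)) (|L| + 1) := by
    refine Set.iUnion₂_subset fun x hx => Metric.closedBall_subset_closedBall' ?_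
    rw [dist_zero_right]
    linarith [hT x hx, le_abs_self L]
  have hdisj : (T : Set (EuclideanSpace ℝ (Fin d))).PairwiseDisjoint
      fun x => Metric.closedBall x (δ / 2) := by
    intro x hx y hy hxy
    refine Metric.closedBall_disjoint_closedBall ?_
    linarith [hsep x hx y hy hxy]
  have h1 := measureReal_mono hsub (μ := volume) measure_closedBall_lt_top.ne
  rw [measureReal_biUnion_finset hdisj (fun _ _ => measurableSet_closedBall)
    (fun _ _ => measure_closedBall_lt_top.ne), hvol _ _ (by positivity),
    Finset.sum_congr rfl fun x _ => hvol x _ (half_pos hδ).le, Finset.sum_const, nsmul_eq_mul,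
    ← mul_assoc] at h1
  exact le_of_mul_le_mul_right h1 (unitBallVolume_pos d)

/-- A maximal `δ`-separated subset is a `δ`-net, and the disjoint balls of radius `δ / 2` about its
points bound its cardinality by volume. -/
theorem exists_net_card_le {S : Set (EuclideanSpace ℝ (Fin d))} (hS : Bornology.IsBounded S) :
    ∃ C : ℝ, 0 < C ∧ ∀ δ : ℝ, 0 < δ → δ ≤ 1 → ∃ T : Finset (EuclideanSpace ℝ (Fin d)),
      (∀ t ∈ T, t ∈ S) ∧ (T.card : ℝ) * δ ^ d ≤ C ∧ ∀ x ∈ S, ∃ t ∈ T, dist x t ≤ δ := by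
  obtain ⟨L, hL⟩ := hS.exists_norm_le
  refine ⟨(|L| + 1) ^ d * 2 ^ d, by positivity, fun δ hδ hδ1 => ?_⟩
  obtain ⟨K, hK⟩ := exists_nat_gt ((|L| + 1) ^ d / (δ / 2) ^ d)
  have hbound : ∀ T : Finset (EuclideanSpace ℝ (Fin d)), (T : Set _) ⊆ S →
      Metric.IsSeparated (δ.toNNReal) (T : Set (EuclideanSpace ℝ (Fin d))) →
      (T.card : ℝ) * (δ / 2) ^ d ≤ (|L| + 1) ^ d := by
    intro T hTS hsep
    refine card_mul_pow_le_of_separated hδ hδ1 (fun x hx => hL x (hTS hx)) fun x hx y hy hxy => ?_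
    have : (δ.toNNReal : ℝ≥0∞) < edist x y := hsep hx hy hxy
    rw [edist_dist] at this
    exact (ENNReal.ofReal_lt_ofReal_iff_of_nonneg hδ.le).1 this
  have hpack : Metric.packingNumber δ.toNNReal S ≤ K := by
    refine iSup₂_le fun C hCS => iSup_le fun hC => ?_
    by_contra! hlt
    obtain ⟨D, hDC, hD⟩ := Set.exists_subset_encard_eq hlt.le
    have hDfin : D.Finite := Set.finite_of_encard_eq_coe hD
    have h := hbound hDfin.toFinset (by simpa using hDC.trans hCS) (by simpa using hC.subset hDC)
    rw [← le_div_iff₀ (by positivity)] at h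
    rw [hDfin.encard_eq_coe_toFinset_card] at hD
    have : hDfin.toFinset.card = K := by exact_mod_cast hD
    rw [this] at h
    linarith
  have hne : Metric.packingNumber δ.toNNReal S ≠ ⊤ := ne_top_of_le_ne_top (by simp) hpack
  have hcover := Metric.isCover_maximalSeparatedSet hne
  have hsubS := Metric.maximalSeparatedSet_subset (A := S) (ε := δ.toNNReal)
  have hsep := Metric.isSeparated_maximalSeparatedSet (A := S) (ε := δ.toNNReal)
  have hfin : (Metric.maximalSeparatedSet δ.toNNReal S).Finite := by
    refine Set.encard_ne_top_iff.1 ?_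
    rw [Metric.encard_maximalSeparatedSet hne]
    exact hne
  refine ⟨hfin.toFinset, fun t ht => hsubS (by simpa using ht), ?_, fun x hx => ?_⟩
  · have h := hbound hfin.toFinset (by simpa using hsubS) (by simpa using hsep)
    rw [div_pow, ← mul_div_assoc, div_le_iff₀ (by positivity)] at h
    exact h
  · obtain ⟨t, ht, hxt⟩ := hcover hx
    refine ⟨t, by simpa using ht, ?_⟩
    replace hxt : edist x t ≤ (δ.toNNReal : ℝ≥0∞) := hxt
    rw [edist_dist] at hxt
    exact (ENNReal.ofReal_le_ofReal_iff hδ.le).1 hxt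

end Volume

/-! ### The radius `ρ_n`. -/

section Radius

theorem ballRadius_pow {d : ℕ} (hd : 0 < d) (c : ℝ) (n : ℕ) :
    ballRadius d c n ^ d = c ^ d * (Real.log n / n) := by
  have h : 0 ≤ Real.log n / n := div_nonneg (Real.log_natCast_nonneg n) n.cast_nonneg
  rw [ballRadius, mul_pow, one_div, Real.rpow_inv_natCast_pow h hd.ne']

theorem ballRadius_pos {d : ℕ} {c : ℝ} (hc : 0 < c) {n : ℕ} (hn : 2 ≤ n) :
    0 < ballRadius d c n := by
  have h1 : 0 < Real.log n := Real.log_pos (by exact_mod_cast hn)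
  have h2 : (0 : ℝ) < n := by positivity
  exact mul_pos hc (Real.rpow_pos_of_pos (div_pos h1 h2) _)

theorem tendsto_ballRadius {d : ℕ} (hd : 0 < d) (c : ℝ) :
    Tendsto (ballRadius d c) atTop (𝓝 0) := by
  have h1 : Tendsto (fun n : ℕ => Real.log n / n) atTop (𝓝 0) :=
    (Real.isLittleO_log_id_atTop.tendsto_div_nhds_zero).comp tendsto_natCast_atTop_atTop
  have hd' : 0 < 1 / (d : ℝ) := by positivity
  have h2 := (h1.rpow_const (p := 1 / (d : ℝ)) (Or.inr hd'.le)).const_mul c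
  rw [Real.zero_rpow hd'.ne', mul_zero] at h2
  exact h2

end Radius

/-! ### Almost sure covering of the support by the sample. -/

section Covering

theorem summable_one_div_rpow_mul_log {β : ℝ} (hβ : 1 < β) :
    Summable fun n : ℕ => 1 / ((n : ℝ) ^ β * Real.log n) := by
  refine Summable.of_norm_bounded_eventually_nat (Real.summable_one_div_nat_rpow.2 hβ) ?_
  filter_upwards [(Real.tendsto_log_atTop.comp tendsto_natCast_atTop_atTop).eventually_ge_atTop 1,
    eventually_gt_atTop 0] with n hn hn0
  simp only [Function.comp_apply] at hn
  have h : 0 < (n : ℝ) ^ β := by positivity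
  rw [Real.norm_of_nonneg (by positivity)]
  exact one_div_le_one_div_of_le h (le_mul_of_one_le_right h.le hn)

theorem ae_eventually_notMem_of_eventually_le {Ω : Type*} [MeasurableSpace Ω] {P : Measure Ω}
    {s : ℕ → Set Ω} {u : ℕ → ℝ} (hu : Summable u)
    (h : ∀ᶠ n in atTop, P (s n) ≤ ENNReal.ofReal (u n)) :
    ∀ᵐ ω ∂P, ∀ᶠ n in atTop, ω ∉ s n := by
  obtain ⟨N, hN⟩ := eventually_atTop.1 h
  have hsum : ∑' n, P {ω | N ≤ n ∧ ω ∈ s n} ≠ ∞ := by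
    refine ne_top_of_le_ne_top hu.tsum_ofReal_ne_top (ENNReal.tsum_le_tsum fun n => ?_)
    by_cases hn : N ≤ n
    · simpa [hn] using hN n hn
    · simp [hn]
  filter_upwards [ae_eventually_notMem hsum] with ω hω
  filter_upwards [hω, eventually_ge_atTop N] with n h1 h2 h3
  exact h1 ⟨h2, h3⟩

variable {d : ℕ} {Ω : Type*} [MeasurableSpace Ω] {P : Measure Ω} [IsProbabilityMeasure P]

theorem IsAlmostIndependent.measure_forall_notMem_le {n : ℕ} (hn : 0 < n)
    {f : EuclideanSpace ℝ (Fin d) → ℝ}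
    {X : Fin n → Ω → EuclideanSpace ℝ (Fin d)} {α : ℝ} (hAI : IsAlmostIndependent X P α)
    (hf : Measurable f) (hf_nonneg : ∀ x, 0 ≤ f x)
    (hlaw : ∀ i, HasLaw (X i) (volume.withDensity fun x => ENNReal.ofReal (f x)) P)
    {B : Set (EuclideanSpace ℝ (Fin d))} (hB : MeasurableSet B) {p : ℝ} (hp : 0 ≤ p)
    (hBp : ENNReal.ofReal p ≤ (volume.withDensity fun x => ENNReal.ofReal (f x)) B) :
    P {ω | ∀ i, X i ω ∉ B} ≤ ENNReal.ofReal ((1 + α) * Real.exp (-(n * p))) := by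
  have hα := hAI.nonneg hf hf_nonneg hlaw
  have := isProbabilityMeasure_of_hasLaw (hlaw ⟨0, hn⟩)
  have h1 : (volume.withDensity fun x => ENNReal.ofReal (f x)) Bᶜ ≤
      ENNReal.ofReal (Real.exp (-p)) := by
    rw [prob_compl_eq_one_sub hB]
    calc _ ≤ 1 - ENNReal.ofReal p := tsub_le_tsub_left hBp _
      _ = ENNReal.ofReal (1 - p) := by rw [ENNReal.ofReal_sub _ hp, ENNReal.ofReal_one]
      _ ≤ _ := ENNReal.ofReal_le_ofReal (Real.one_sub_le_exp_neg p)
  calc P {ω | ∀ i, X i ω ∉ B} ≤ _ := hAI.measure_forall_mem_le hf hf_nonneg hlaw hB.compl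
    _ ≤ ENNReal.ofReal (1 + α) * ENNReal.ofReal (Real.exp (-p)) ^ n := by gcongr
    _ = _ := by
      rw [← ENNReal.ofReal_pow (Real.exp_pos _).le, ← Real.exp_nat_mul,
        ENNReal.ofReal_mul (by linarith), mul_neg]

/-- One factor `θ` pays for shrinking the radius to `θ ρ`, the other for the half-ball loss `1 - θ ρ
/ R₁ ≥ θ`. -/
theorem exists_contraction {a : ℝ} (ha : 3 < a) (d : ℕ) :
    ∃ θ : ℝ, 0 < θ ∧ θ < 1 ∧ 2 < a * (θ * θ) ^ d := by
  have h : Tendsto (fun θ : ℝ => a * (θ * θ) ^ d) (𝓝[<] 1) (𝓝 (a * (1 * 1) ^ d)) :=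
    (Continuous.tendsto (by fun_prop) 1).mono_left nhdsWithin_le_nhds
  have h1 := h.eventually (lt_mem_nhds (show 2 < a * (1 * 1) ^ d by simp; linarith))
  obtain ⟨θ, h2, h3⟩ := (h1.and (Ioo_mem_nhdsLT zero_lt_one)).exists
  exact ⟨θ, h3.1, h3.2, h2⟩

theorem lt_mul_pow_of_rpow_lt (hd : 0 < d) {f₀ c : ℝ} (hf₀ : 0 < f₀)
    (hc : (6 / (f₀ * unitBallVolume d)) ^ (1 / (d : ℝ)) < c) :
    3 < f₀ * (unitBallVolume d / 2) * c ^ d := by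
  have hω := unitBallVolume_pos d
  have h0 : 0 ≤ 6 / (f₀ * unitBallVolume d) := by positivity
  have h := pow_lt_pow_left₀ hc (Real.rpow_nonneg h0 _) hd.ne'
  rw [one_div, Real.rpow_inv_natCast_pow h0 hd.ne', div_lt_iff₀ (by positivity)] at h
  linarith

/-- Almost surely the sample is eventually a `κ * ballRadius d c n`-net of the support, for some
`κ < 1`. -/
theorem exists_ae_eventually_net (hd : 0 < d)
    {M : Set (EuclideanSpace ℝ (Fin d))} (hM : IsCompact M) {R₁ : ℝ} (hR₁ : 0 < R₁)
    {f : EuclideanSpace ℝ (Fin d) → ℝ} (hf : Measurable f) (hf_nonneg : ∀ x, 0 ≤ f x)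
    {f₀ : ℝ} (hf₀ : 0 < f₀) (hf_lower : ∀ x ∈ Metric.cthickening R₁ M, f₀ ≤ f x)
    {X : (n : ℕ) → Fin n → Ω → EuclideanSpace ℝ (Fin d)}
    (hlaw : ∀ (n : ℕ) (i : Fin n),
      HasLaw (X n i) (volume.withDensity fun x => ENNReal.ofReal (f x)) P)
    {α : ℕ → ℝ} (hAI : ∀ n : ℕ, 0 < n → IsAlmostIndependent (X n) P (α n))
    (hα : ∀ β : ℝ, 1 < β → Summable fun n : ℕ => α n / ((n : ℝ) ^ β * Real.log n))
    {c : ℝ} (hc : (6 / (f₀ * unitBallVolume d)) ^ (1 / (d : ℝ)) < c) :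
    ∃ κ : ℝ, κ < 1 ∧ ∀ᵐ ω ∂P, ∀ᶠ n : ℕ in atTop, ∀ x ∈ Metric.cthickening R₁ M,
      ∃ i, dist x (X n i ω) ≤ κ * ballRadius d c n := by
  have hω := unitBallVolume_pos d
  have hc0 : 0 < c := (Real.rpow_nonneg (by positivity) _).trans_lt hc
  obtain ⟨θ, hθ0, hθ1, hθ⟩ := exists_contraction (lt_mul_pow_of_rpow_lt hd hf₀ hc) d
  set γ := f₀ * (unitBallVolume d / 2) * c ^ d * (θ * θ) ^ d with hγ
  obtain ⟨C, hC, hnet⟩ := exists_net_card_le (hM.isBounded.cthickening (δ := R₁))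
  set C' := C / ((1 - θ) / 2 * c) ^ d with hC'
  have hθ' : 0 < (1 - θ) / 2 := by linarith
  have hC'0 : 0 < C' := by positivity
  refine ⟨(1 + θ) / 2, by linarith, ?_⟩
  -- The net has at most `C' n / log n` points, each missed with probability at most `(1 + α n)
  -- n^(-γ)`; here `γ - 1 > 1`.
  have hsum : Summable fun n : ℕ => C' * (1 / ((n : ℝ) ^ (γ - 1) * Real.log n) +
      α n / ((n : ℝ) ^ (γ - 1) * Real.log n)) :=
    ((summable_one_div_rpow_mul_log (by linarith)).add (hα _ (by linarith))).mul_left _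
  have hmain := ae_eventually_notMem_of_eventually_le (P := P)
    (s := fun n => {ω | ∃ x ∈ Metric.cthickening R₁ M,
      ∀ i, (1 + θ) / 2 * ballRadius d c n < dist x (X n i ω)}) hsum ?_
  · filter_upwards [hmain] with ω hω
    filter_upwards [hω] with n hn x hx
    by_contra! hcon
    exact hn ⟨x, hx, hcon⟩
  have hρ := tendsto_ballRadius hd c
  filter_upwards [eventually_ge_atTop 2, hρ.eventually (gt_mem_nhds hR₁),
    hρ.eventually (gt_mem_nhds (show 0 < (1 - θ) * R₁ by nlinarith)),
    hρ.eventually (gt_mem_nhds zero_lt_one)] with n hn h1 h2 h3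
  set ρ := ballRadius d c n with hρn
  have hρ0 : 0 < ρ := ballRadius_pos hc0 hn
  have hn0 : (0 : ℝ) < n := by positivity
  have hlog : 0 < Real.log n := Real.log_pos (by exact_mod_cast hn)
  have hα0 : 0 ≤ α n := (hAI n (by lia)).nonneg hf hf_nonneg (hlaw n)
  -- The mesh is the gap between `θ ρ` and `(1 + θ) / 2 * ρ`: hitting every ball of radius `θ ρ`
  -- about the net gives the stated covering.
  obtain ⟨T, hTS, hTcard, hT⟩ := hnet ((1 - θ) / 2 * ρ) (by positivity) (by nlinarith)
  have hsub : {ω | ∃ x ∈ Metric.cthickening R₁ M, ∀ i, (1 + θ) / 2 * ρ < dist x (X n i ω)} ⊆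
      ⋃ t ∈ T, {ω | ∀ i, X n i ω ∉ Metric.closedBall t (θ * ρ)} := by
    rintro ω ⟨x, hx, hxi⟩
    obtain ⟨t, ht, hxt⟩ := hT x hx
    refine Set.mem_iUnion₂.2 ⟨t, ht, fun i hi => ?_⟩
    rw [Metric.mem_closedBall] at hi
    have := hxi i
    have := dist_triangle_right x (X n i ω) t
    linarith
  have hball : ∀ t ∈ T, P {ω | ∀ i, X n i ω ∉ Metric.closedBall t (θ * ρ)} ≤
      ENNReal.ofReal ((1 + α n) * (n : ℝ) ^ (-γ)) := by
    intro t ht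
    have hθρ : θ ≤ 1 - θ * ρ / R₁ := by
      rw [le_sub_comm, div_le_iff₀ hR₁]
      nlinarith
    have hp := ofReal_mul_le_withDensity_closedBall hd hM hR₁ hf₀.le hf_lower
      (show 0 ≤ θ * ρ by positivity) (by nlinarith) (hTS t ht)
    have hp' : ENNReal.ofReal (γ * (Real.log n / n)) ≤
        (volume.withDensity fun x => ENNReal.ofReal (f x)) (Metric.closedBall t (θ * ρ)) := by
      refine le_trans (ENNReal.ofReal_le_ofReal ?_) hp
      calc γ * (Real.log n / n) = f₀ * (unitBallVolume d / 2 * (θ * ρ * θ) ^ d) := by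
            rw [mul_pow, mul_pow, hρn, ballRadius_pow hd, hγ, mul_pow]; ring
        _ ≤ _ := by gcongr
    refine ((hAI n (by lia)).measure_forall_notMem_le (by lia) hf hf_nonneg (hlaw n)
      measurableSet_closedBall (by positivity) hp').trans (ENNReal.ofReal_le_ofReal ?_)
    rw [Real.rpow_def_of_pos hn0]
    apply le_of_eq
    congr 2
    field_simp
  calc P {ω | ∃ x ∈ Metric.cthickening R₁ M, ∀ i, (1 + θ) / 2 * ρ < dist x (X n i ω)}
      ≤ P (⋃ t ∈ T, {ω | ∀ i, X n i ω ∉ Metric.closedBall t (θ * ρ)}) := measure_mono hsub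
    _ ≤ ∑ t ∈ T, P {ω | ∀ i, X n i ω ∉ Metric.closedBall t (θ * ρ)} :=
        measure_biUnion_finset_le _ _
    _ ≤ ∑ t ∈ T, ENNReal.ofReal ((1 + α n) * (n : ℝ) ^ (-γ)) := Finset.sum_le_sum hball
    _ = ENNReal.ofReal (T.card * ((1 + α n) * (n : ℝ) ^ (-γ))) := by
        rw [Finset.sum_const, nsmul_eq_mul, ENNReal.ofReal_mul (Nat.cast_nonneg _),
          ENNReal.ofReal_natCast]
    _ ≤ _ := by
        refine ENNReal.ofReal_le_ofReal ?_
        have hcard : (T.card : ℝ) ≤ C' * (n / Real.log n) := by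
          have h4 : ((1 - θ) / 2 * ρ) ^ d = ((1 - θ) / 2 * c) ^ d * (Real.log n / n) := by
            rw [mul_pow, hρn, ballRadius_pow hd, mul_pow, mul_assoc]
          rw [h4, ← mul_div_assoc, ← mul_div_assoc, div_le_iff₀ hn0] at hTcard
          rw [hC', div_mul_div_comm, le_div_iff₀ (by positivity)]
          exact hTcard
        calc (T.card : ℝ) * ((1 + α n) * (n : ℝ) ^ (-γ))
            ≤ C' * (n / Real.log n) * ((1 + α n) * (n : ℝ) ^ (-γ)) := by gcongr
          _ = _ := by
            rw [Real.rpow_sub_one hn0.ne', Real.rpow_neg hn0.le]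
            have : (n : ℝ) ^ γ ≠ 0 := by positivity
            field_simp

omit [IsProbabilityMeasure P] in
theorem ae_forall_mem_support {μ : Measure (EuclideanSpace ℝ (Fin d))}
    {X : (n : ℕ) → Fin n → Ω → EuclideanSpace ℝ (Fin d)}
    (hlaw : ∀ (n : ℕ) (i : Fin n), HasLaw (X n i) μ P) :
    ∀ᵐ ω ∂P, ∀ n i, X n i ω ∈ μ.support := by
  refine ae_all_iff.2 fun n => ae_all_iff.2 fun i => ?_
  refine ae_of_ae_map (hlaw n i).aemeasurable (p := fun x => x ∈ μ.support) ?_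
  rw [(hlaw n i).map_eq]
  exact Measure.support_mem_ae

end Covering

/-! ### Increasing the distance to `M` below the reach. -/

section Ascent

variable {d : ℕ} {M : Set (EuclideanSpace ℝ (Fin d))}

theorem mem_cthickening_iff_infDist_le {E : Type*} [PseudoMetricSpace E] {A : Set E}
    (hA : A.Nonempty) {r : ℝ} (hr : 0 ≤ r) {x : E} :
    x ∈ Metric.cthickening r A ↔ Metric.infDist x A ≤ r := by
  rw [Metric.mem_cthickening_iff, Metric.infDist, ENNReal.le_ofReal_iff_toReal_le
    (Metric.infEDist_ne_top hA) hr]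

theorem reach_le_ofReal_infDist {x p q : EuclideanSpace ℝ (Fin d)}
    (hp : p ∈ orthProjections M x) (hq : q ∈ orthProjections M x) (hpq : p ≠ q) :
    reach M ≤ ENNReal.ofReal (Metric.infDist x M) := by
  have hx : x ∈ medialAxis M := ⟨p, hp, q, hq, hpq⟩
  calc reach M ≤ reachAt M p := iInf₂_le p hp.1
    _ ≤ edist p x := iInf₂_le x hx
    _ = _ := by rw [edist_comm, edist_dist, hp.2]

/-- The distance to a compact set grows at almost unit speed along the outward normal at a point
which has a unique projection. -/
theorem exists_infDist_ge_add_of_unique_projection (hM : IsCompact M)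
    {y p : EuclideanSpace ℝ (Fin d)} (hp : p ∈ orthProjections M y)
    (huniq : ∀ q ∈ orthProjections M y, q = p) (hy : 0 < Metric.infDist y M) {l : ℝ} (hl : l < 1)
    {ε : ℝ} (hε : 0 < ε) :
    ∃ y', y' ≠ y ∧ dist y y' ≤ ε ∧ Metric.infDist y M + l * dist y y' ≤ Metric.infDist y' M := by
  set D := Metric.infDist y M with hD
  have hyp : ‖y - p‖ = D := by rw [← dist_eq_norm, hp.2]
  set v := D⁻¹ • (y - p) with hv
  have hv1 : ‖v‖ = 1 := by
    rw [hv, norm_smul, hyp, Real.norm_of_nonneg (by positivity), inv_mul_cancel₀ hy.ne']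
  -- At `q = p` the two sides are `l * D` and `D`; continuity extends the strict inequality to
  -- points near `p`.
  have hnear : ∀ᶠ q in 𝓝 p, l * ‖y - q‖ < inner ℝ v (y - q) := by
    refine Tendsto.eventually_lt (f := fun q => l * ‖y - q‖) (g := fun q => inner ℝ v (y - q))
      (Continuous.tendsto (by fun_prop) p) (Continuous.tendsto (by fun_prop) p) ?_
    rw [hv, inner_smul_left, real_inner_self_eq_norm_sq, hyp]
    simp only [conj_trivial]
    field_simp
    nlinarith
  obtain ⟨δ, hδ, hball⟩ := Metric.eventually_nhds_iff_ball.1 hnear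
  -- Uniqueness of the projection and compactness leave a gap, so a step of length at most `g / 2`
  -- cannot make these points too close.
  have hfar : ∃ g > 0, ∀ q ∈ M \ Metric.ball p δ, D + g ≤ dist y q := by
    have hK : IsCompact (M \ Metric.ball p δ) := hM.diff Metric.isOpen_ball
    rcases (M \ Metric.ball p δ).eq_empty_or_nonempty with h | h
    · exact ⟨1, one_pos, by simp [h]⟩
    · obtain ⟨q, hq, hmin⟩ := hK.exists_isMinOn h
        (f := fun q => dist y q) (by fun_prop)
      have h1 : D < dist y q := by
        refine lt_of_le_of_ne (Metric.infDist_le_dist_of_mem hq.1) fun heq => hq.2 ?_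
        rw [huniq q ⟨hq.1, heq.symm⟩]
        exact Metric.mem_ball_self hδ
      exact ⟨dist y q - D, by linarith, fun q' hq' => by
        have : dist y q ≤ dist y q' := hmin hq'
        linarith⟩
  obtain ⟨g, hg, hgap⟩ := hfar
  set h := min ε (g / 2) with hh
  have hh0 : 0 < h := lt_min hε (by positivity)
  have hdist : dist y (y + h • v) = h := by
    rw [dist_self_add_right, norm_smul, hv1, Real.norm_of_nonneg hh0.le, mul_one]
  refine ⟨y + h • v, ?_, hdist.le.trans (min_le_left _ _), ?_⟩
  · rw [← dist_pos, dist_comm, hdist]; exact hh0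
  rw [hdist]
  refine (Metric.le_infDist ⟨p, hp.1⟩).2 fun {q} hq => ?_
  by_cases hqb : q ∈ Metric.ball p δ
  · have h1 := hball q hqb
    have hDq : D ≤ ‖y - q‖ := by
      rw [← dist_eq_norm]; exact Metric.infDist_le_dist_of_mem hq
    have h2 : inner ℝ (y + h • v - q) (y - q) ≤ ‖y + h • v - q‖ * ‖y - q‖ :=
      real_inner_le_norm _ _
    rw [show y + h • v - q = (y - q) + h • v by abel, inner_add_left, inner_smul_left,
      real_inner_self_eq_norm_sq, ← show y + h • v - q = (y - q) + h • v by abel] at h2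
    simp only [conj_trivial] at h2
    have hpos : 0 < ‖y - q‖ := hy.trans_le hDq
    rw [dist_eq_norm]
    refine le_trans (by gcongr : D + l * h ≤ ‖y - q‖ + l * h) ?_
    refine le_of_mul_le_mul_right ?_ hpos
    nlinarith
  · have h1 := hgap q ⟨hq, hqb⟩
    have h2 := dist_triangle y (y + h • v) q
    have h3 : h ≤ g / 2 := min_le_right _ _
    rw [hdist] at h2
    nlinarith

/-- Starting from a point outside `M`, every distance to `M` up to the reach is attained after a
displacement of almost the least possible length. -/
theorem exists_infDist_eq_of_le_reach (hM : IsCompact M) (hne : M.Nonempty) {T : ℝ}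
    (hT : ENNReal.ofReal T ≤ reach M) {x : EuclideanSpace ℝ (Fin d)}
    (hx : 0 < Metric.infDist x M) (hxT : Metric.infDist x M ≤ T) {l : ℝ} (hl0 : 0 < l)
    (hl : l < 1) :
    ∃ y, Metric.infDist y M = T ∧ l * dist x y ≤ T - Metric.infDist x M := by
  -- Maximising the distance over this compact set replaces a gradient flow: a maximiser below level
  -- `T` has a unique projection by the reach bound, and one more ascent step would stay in `A` and
  -- improve it.
  set A := {y | Metric.infDist x M + l * dist x y ≤ Metric.infDist y M ∧ Metric.infDist y M ≤ T}
    with hA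
  have hc := Metric.continuous_infDist_pt M
  have hAclosed : IsClosed A :=
    (isClosed_le (by fun_prop) hc).inter (isClosed_le hc continuous_const)
  have hAbdd : Bornology.IsBounded A := by
    refine Metric.isBounded_closedBall (x := x) (r := T / l) |>.subset fun y hy => ?_
    rw [Metric.mem_closedBall, dist_comm, le_div_iff₀ hl0]
    linarith [hy.1, hy.2]
  obtain ⟨y, hy, hmax⟩ := (Metric.isCompact_of_isClosed_isBounded hAclosed hAbdd).exists_isMaxOn
    (f := fun y => Metric.infDist y M) ⟨x, by simp [hA, hxT]⟩ hc.continuousOn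
  refine ⟨y, ?_, by linarith [hy.1, hy.2]⟩
  by_contra hyT
  have hlt : Metric.infDist y M < T := lt_of_le_of_ne hy.2 hyT
  have hy0 : 0 < Metric.infDist y M := by
    have := hy.1
    have : 0 ≤ l * dist x y := by positivity
    linarith
  obtain ⟨p, hpM, hp⟩ := hM.exists_infDist_eq_dist hne y
  have hproj : p ∈ orthProjections M y := ⟨hpM, hp.symm⟩
  obtain ⟨y', hy'ne, hy'ε, hy'⟩ := exists_infDist_ge_add_of_unique_projection hM hproj
    (fun q hq => by
      by_contra hqp
      have h1 := hT.trans (reach_le_ofReal_infDist hq hproj hqp)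
      rw [ENNReal.ofReal_le_ofReal_iff hy0.le] at h1
      linarith) hy0 hl (sub_pos.2 hlt)
  have hpos : 0 < l * dist y y' := mul_pos hl0 (dist_pos.2 hy'ne.symm)
  have hy'A : y' ∈ A := by
    refine ⟨?_, ?_⟩
    · have h1 : l * dist x y' ≤ l * (dist x y + dist y y') := by
        gcongr; exact dist_triangle _ _ _
      linarith [hy.1]
    · have := Metric.infDist_le_infDist_add_dist (s := M) (x := y') (y := y)
      rw [dist_comm] at this
      linarith
  have : Metric.infDist y' M ≤ Metric.infDist y M := hmax hy'A
  linarith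

theorem exists_infDist_eq_dist_le_of_le_reach (hM : IsCompact M) (hne : M.Nonempty) {T : ℝ}
    (hT : ENNReal.ofReal T ≤ reach M) {x : EuclideanSpace ℝ (Fin d)}
    (hx : 0 < Metric.infDist x M) (hxT : Metric.infDist x M ≤ T) {ε : ℝ} (hε : 0 < ε) :
    ∃ y, Metric.infDist y M = T ∧ dist x y ≤ T - Metric.infDist x M + ε := by
  set s := T - Metric.infDist x M
  have hs : 0 ≤ s := sub_nonneg.2 hxT
  -- This speed gives `dist x y ≤ s (s + ε) / (s + ε / 2) ≤ s + ε`, and it remains in `(0, 1)` when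
  -- `s = 0`.
  obtain ⟨y, hy, hxy⟩ := exists_infDist_eq_of_le_reach hM hne hT hx hxT
    (l := (s + ε / 2) / (s + ε)) (by positivity) (by rw [div_lt_one (by positivity)]; linarith)
  refine ⟨y, hy, ?_⟩
  rw [div_mul_eq_mul_div, div_le_iff₀ (by positivity)] at hxy
  by_contra! hcon
  have : (s + ε / 2) * (s + ε) ≤ (s + ε / 2) * dist x y := by gcongr
  nlinarith

end Ascent

/-! ### Locating boundary balls. -/

section BoundaryBalls

variable {d n : ℕ} {M : Set (EuclideanSpace ℝ (Fin d))} {x : Fin n → EuclideanSpace ℝ (Fin d)}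
  {r R : ℝ}

theorem isClosed_devroyeWise (x : Fin n → EuclideanSpace ℝ (Fin d)) (r : ℝ) :
    IsClosed (devroyeWise x r) :=
  isClosed_iUnion_of_finite fun _ => Metric.isClosed_closedBall

theorem ball_subset_interior_devroyeWise (x : Fin n → EuclideanSpace ℝ (Fin d)) (r : ℝ)
    (i : Fin n) : Metric.ball (x i) r ⊆ interior (devroyeWise x r) :=
  interior_maximal (Metric.ball_subset_closedBall.trans
    (Set.subset_iUnion (fun i => Metric.closedBall (x i) r) i)) Metric.isOpen_ball

theorem exists_isBoundaryBall_of_mem_frontier (hr : 0 < r) {w : EuclideanSpace ℝ (Fin d)}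
    (hw : w ∈ frontier (devroyeWise x r)) : ∃ j, IsBoundaryBall x r j ∧ dist w (x j) = r := by
  have hmem : w ∈ devroyeWise x r := (isClosed_devroyeWise x r).frontier_subset hw
  obtain ⟨j, hj⟩ := Set.mem_iUnion.1 hmem
  have hdist : dist w (x j) = r := by
    refine le_antisymm hj (not_lt.1 fun hlt => hw.2 ?_)
    exact ball_subset_interior_devroyeWise x r j hlt
  refine ⟨j, ⟨w, ?_, hw⟩, hdist⟩
  rw [frontier_closedBall _ hr.ne']
  exact hdist

/-- Guards the lower bounds against an infimum over the empty type, which would be `0` in `ℝ`. -/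
theorem exists_isBoundaryBall (hd : 0 < d) (hn : 0 < n) (hr : 0 < r) :
    ∃ j, IsBoundaryBall x r j := by
  have : Nonempty (Fin d) := ⟨⟨0, hd⟩⟩
  have hne : (devroyeWise x r).Nonempty :=
    ⟨x ⟨0, hn⟩, Set.mem_iUnion.2 ⟨_, Metric.mem_closedBall_self hr.le⟩⟩
  have hbdd : Bornology.IsBounded (devroyeWise x r) :=
    Bornology.isBounded_iUnion.2 fun _ => Metric.isBounded_closedBall
  have huniv : devroyeWise x r ≠ Set.univ := fun h =>
    NormedSpace.unbounded_univ ℝ (EuclideanSpace ℝ (Fin d)) (h ▸ hbdd)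
  obtain ⟨w, hw⟩ := nonempty_frontier_iff.2 ⟨hne, huniv⟩
  obtain ⟨j, hj, -⟩ := exists_isBoundaryBall_of_mem_frontier hr hw
  exact ⟨j, hj⟩

theorem subset_interior_devroyeWise {S : Set (EuclideanSpace ℝ (Fin d))}
    (hcov : ∀ y ∈ S, ∃ i, dist y (x i) < r) : S ⊆ interior (devroyeWise x r) := by
  intro y hy
  obtain ⟨i, hi⟩ := hcov y hy
  exact ball_subset_interior_devroyeWise x r i hi

theorem IsBoundaryBall.lt_infDist (hne : M.Nonempty) (hR : 0 ≤ R) (hr : 0 < r)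
    (hcov : ∀ y ∈ Metric.cthickening R M, ∃ i, dist y (x i) < r) {j : Fin n}
    (hj : IsBoundaryBall x r j) : R - r < Metric.infDist (x j) M := by
  obtain ⟨w, hw, hw'⟩ := hj
  rw [frontier_closedBall _ hr.ne', Metric.mem_sphere] at hw
  have hwS : w ∉ Metric.cthickening R M := fun h =>
    hw'.2 (subset_interior_devroyeWise hcov h)
  rw [mem_cthickening_iff_infDist_le hne hR, not_le] at hwS
  linarith [Metric.infDist_le_infDist_add_dist (s := M) (x := w) (y := x j)]

theorem exists_mem_segment_frontier {E : Type*} [NormedAddCommGroup E] [NormedSpace ℝ E]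
    {D : Set E} (hD : IsClosed D) {a b : E} (ha : a ∈ D) (hb : b ∉ D) :
    ∃ w ∈ segment ℝ a b, w ∈ frontier D := by
  by_contra! hcon
  have hint : ∀ w ∈ segment ℝ a b, w ∈ D → w ∈ interior D := by
    intro w hw hwD
    by_contra h
    exact hcon w hw ⟨subset_closure hwD, h⟩
  obtain ⟨w, -, hw1, hw2⟩ := (convex_segment (𝕜 := ℝ) a b).isPreconnected (interior D) Dᶜ
    isOpen_interior hD.isOpen_compl
    (fun w hw => (em (w ∈ D)).imp (hint w hw) id)
    ⟨a, left_mem_segment ℝ a b, hint a (left_mem_segment ℝ a b) ha⟩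
    ⟨b, right_mem_segment ℝ a b, hb⟩
  exact hw2 (interior_subset hw1)

theorem exists_isBoundaryBall_dist_le_of_notMem (hM : IsCompact M) (hne : M.Nonempty) (hR : 0 ≤ R)
    (hr : 0 < r) (hmem : ∀ i, x i ∈ Metric.cthickening R M)
    (hcov : ∀ y ∈ Metric.cthickening R M, ∃ i, dist y (x i) < r)
    {T : ℝ} (hT : ENNReal.ofReal T ≤ reach M) (hRT : R + r < T)
    {z : EuclideanSpace ℝ (Fin d)} (hz : z ∈ Metric.cthickening R M) (hzM : z ∉ M)
    {ε : ℝ} (hε : 0 < ε) :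
    ∃ j, IsBoundaryBall x r j ∧ dist z (x j) ≤ T + r + ε := by
  have hzR := (mem_cthickening_iff_infDist_le hne hR).1 hz
  have hz0 : 0 < Metric.infDist z M := (hM.isClosed.notMem_iff_infDist_pos hne).1 hzM
  obtain ⟨y, hyT, hzy⟩ := exists_infDist_eq_dist_le_of_le_reach hM hne hT hz0 (by linarith) hε
  -- Centres lie within `R` of `M`, so the estimator stays within `R + r < T` of `M`.
  have hy : y ∉ devroyeWise x r := by
    intro hy
    obtain ⟨i, hi⟩ := Set.mem_iUnion.1 hy
    rw [Metric.mem_closedBall] at hi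
    have h1 := (mem_cthickening_iff_infDist_le hne hR).1 (hmem i)
    linarith [Metric.infDist_le_infDist_add_dist (s := M) (x := y) (y := x i)]
  obtain ⟨w, hw, hwf⟩ := exists_mem_segment_frontier (isClosed_devroyeWise x r)
    (interior_subset (subset_interior_devroyeWise hcov hz)) hy
  obtain ⟨j, hj, hwj⟩ := exists_isBoundaryBall_of_mem_frontier hr hwf
  refine ⟨j, hj, ?_⟩
  have h1 := dist_triangle z w (x j)
  have h2 := dist_add_dist_of_mem_segment hw
  linarith [dist_nonneg (x := w) (y := y)]

theorem exists_isBoundaryBall_dist_le (hM : IsCompact M) (hne : M.Nonempty)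
    (hint : interior M = ∅) (hR : 0 < R)
    (hr : 0 < r) (hmem : ∀ i, x i ∈ Metric.cthickening R M)
    (hcov : ∀ y ∈ Metric.cthickening R M, ∃ i, dist y (x i) < r)
    (hreach : ENNReal.ofReal (R + r) < reach M)
    {z : EuclideanSpace ℝ (Fin d)} (hz : z ∈ Metric.cthickening R M) {ε : ℝ} (hε : 0 < ε) :
    ∃ j, IsBoundaryBall x r j ∧ dist z (x j) ≤ R + 2 * r + ε := by
  obtain ⟨T, hT0, hT1, hT2⟩ := ENNReal.lt_iff_exists_real_btwn.1 hreach
  have hT3 : R + r < T := by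
    by_contra! h
    exact absurd hT1 (not_lt.2 (ENNReal.ofReal_le_ofReal h))
  -- The target level exceeds `R + r` by at most `ε / 3`; the other two thirds pay for leaving `M`
  -- and for the ascent.
  have hmin : ENNReal.ofReal (min T (R + r + ε / 3)) ≤ reach M :=
    (ENNReal.ofReal_le_ofReal (min_le_left _ _)).trans hT2.le
  obtain ⟨z', hz'S, hz'M, hzz'⟩ : ∃ z' ∈ Metric.cthickening R M, z' ∉ M ∧ dist z z' ≤ ε / 3 := by
    by_cases hzM : z ∈ M
    · obtain ⟨z', hz', hd'⟩ := (interior_eq_empty_iff_dense_compl.1 hint).exists_dist_lt z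
        (show 0 < min (ε / 3) R by positivity)
      refine ⟨z', ?_, hz', (hd'.trans_le (min_le_left _ _)).le⟩
      refine (mem_cthickening_iff_infDist_le hne hR.le).2 ?_
      have h := Metric.infDist_le_dist_of_mem (x := z') hzM
      rw [dist_comm] at h
      linarith [min_le_right (ε / 3) R]
    · exact ⟨z, hz, hzM, by simp; positivity⟩
  obtain ⟨j, hj, hdist⟩ := exists_isBoundaryBall_dist_le_of_notMem hM hne hR.le hr hmem hcov hmin
    (lt_min hT3 (by linarith)) hz'S hz'M (show 0 < ε / 3 by positivity)
  refine ⟨j, hj, ?_⟩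
  linarith [dist_triangle z z' (x j), min_le_right T (R + r + ε / 3)]

end BoundaryBalls

/-! ### Deterministic bounds for the estimator of the radius. -/

section MaxMin

variable {d n : ℕ} {M : Set (EuclideanSpace ℝ (Fin d))} {x : Fin n → EuclideanSpace ℝ (Fin d)}
  {r R : ℝ}

theorem maxMinBoundaryDist_le (hn : 0 < n) {b : ℝ}
    (h : ∀ i, ∀ ε > 0, ∃ j, IsBoundaryBall x r j ∧ dist (x i) (x j) ≤ b + ε) :
    maxMinBoundaryDist x r ≤ b := by
  have : Nonempty (Fin n) := ⟨⟨0, hn⟩⟩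
  refine ciSup_le fun i => le_of_forall_pos_le_add fun ε hε => ?_
  obtain ⟨j, hj, hij⟩ := h i ε hε
  exact ciInf_le_of_le (Set.finite_range _).bddBelow ⟨j, hj⟩ hij

theorem le_maxMinBoundaryDist (hex : ∃ j, IsBoundaryBall x r j) {b : ℝ} (i : Fin n)
    (h : ∀ j, IsBoundaryBall x r j → b ≤ dist (x i) (x j)) : b ≤ maxMinBoundaryDist x r := by
  have : Nonempty {j : Fin n // IsBoundaryBall x r j} := ⟨⟨_, hex.choose_spec⟩⟩
  exact le_ciSup_of_le (Set.finite_range _).bddAbove i (le_ciInf fun j => h j j.2)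

theorem abs_maxMinBoundaryDist_sub_le (hd : 0 < d) (hn : 0 < n) (hM : IsCompact M)
    (hne : M.Nonempty) (hint : interior M = ∅) (hR : 0 < R)
    (hr : 0 < r) (hmem : ∀ i, x i ∈ Metric.cthickening R M)
    (hcov : ∀ y ∈ Metric.cthickening R M, ∃ i, dist y (x i) < r)
    (hreach : ENNReal.ofReal (R + r) < reach M) :
    |maxMinBoundaryDist x r - R| ≤ 2 * r := by
  have hupper : maxMinBoundaryDist x r ≤ R + 2 * r := maxMinBoundaryDist_le hn fun i ε hε =>
    exists_isBoundaryBall_dist_le hM hne hint hR hr hmem hcov hreach (hmem i) hε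
  have hlower : R - 2 * r ≤ maxMinBoundaryDist x r := by
    obtain ⟨m, hm⟩ := hne
    obtain ⟨i, hi⟩ := hcov m (Metric.self_subset_cthickening M hm)
    refine le_maxMinBoundaryDist (exists_isBoundaryBall hd hn hr) i fun j hj => ?_
    have h1 := hj.lt_infDist ⟨m, hm⟩ hR.le hr hcov
    have h2 := Metric.infDist_le_dist_of_mem (x := x j) hm
    linarith [dist_triangle_right (x j) m (x i), dist_comm (x i) (x j), dist_comm m (x i)]
  exact abs_le.2 ⟨by linarith, by linarith⟩

/-- The segment from `y` to `z` already meets `A` at distance `η` before `z`. -/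
theorem infDist_add_le_dist_of_closedBall_subset {E : Type*} [NormedAddCommGroup E]
    [NormedSpace ℝ E] {A : Set E} {z y : E} {η : ℝ} (hη : 0 ≤ η)
    (hA : Metric.closedBall z η ⊆ A) (hy : y ∉ A) : Metric.infDist y A + η ≤ dist y z := by
  have hlt : η < dist y z := not_le.1 fun h => hy (hA h)
  have hpos : 0 < dist y z := hη.trans_lt hlt
  have hq : AffineMap.lineMap z y (η / dist y z) ∈ A := by
    apply hA
    rw [Metric.mem_closedBall, dist_lineMap_left, Real.norm_of_nonneg (by positivity),
      dist_comm z y, div_mul_cancel₀ _ hpos.ne']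
  have h1 := Metric.infDist_le_dist_of_mem (x := y) hq
  rw [dist_right_lineMap, dist_comm z y, Real.norm_of_nonneg
    (sub_nonneg.2 ((div_le_one hpos).2 hlt.le)), sub_mul, div_mul_cancel₀ _ hpos.ne'] at h1
  linarith

theorem add_le_maxMinBoundaryDist (hd : 0 < d) (hn : 0 < n) {z : EuclideanSpace ℝ (Fin d)} {η : ℝ}
    (hη : 0 ≤ η) (hz : Metric.closedBall z η ⊆ M) (hR : 0 < R) (hr : 0 < r) (hrR : r ≤ R)
    (hcov : ∀ y ∈ Metric.cthickening R M, ∃ i, dist y (x i) < r) :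
    R + η - 2 * r ≤ maxMinBoundaryDist x r := by
  have hzM : z ∈ M := hz (Metric.mem_closedBall_self hη)
  obtain ⟨i, hi⟩ := hcov z (Metric.self_subset_cthickening M hzM)
  refine le_maxMinBoundaryDist (exists_isBoundaryBall hd hn hr) i fun j hj => ?_
  have h1 := hj.lt_infDist ⟨z, hzM⟩ hR.le hr hcov
  have hjM : x j ∉ M := fun h => by
    rw [Metric.infDist_zero_of_mem h] at h1
    linarith
  have h2 := infDist_add_le_dist_of_closedBall_subset hη hz hjM
  linarith [dist_triangle_right (x j) z (x i), dist_comm (x i) (x j), dist_comm z (x i)]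

end MaxMin

/-! ### The main theorem. -/

theorem mainTheorem3 {d : ℕ} (hd : 0 < d)
    {Ω : Type*} [MeasurableSpace Ω] (P : Measure Ω) [IsProbabilityMeasure P]
    (M : Set (EuclideanSpace ℝ (Fin d))) (hM : IsCompact M)
    (R₀ : ℝ≥0∞) (hR₀ : 0 < R₀) (hreach : reach M = R₀)
    (R₁ : ℝ) (hR₁ : 0 < R₁) (hR₁₀ : ENNReal.ofReal R₁ < R₀)
    -- the common density `f` of the observations
    (f : EuclideanSpace ℝ (Fin d) → ℝ) (hf : Measurable f) (hf_nonneg : ∀ x, 0 ≤ f x)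
    (hsupp : (volume.withDensity fun x => ENNReal.ofReal (f x)).support =
      Metric.cthickening R₁ M)
    (f₀ : ℝ) (hf₀ : 0 < f₀) (hf_lower : ∀ x ∈ Metric.cthickening R₁ M, f₀ ≤ f x)
    -- `X n 0, …, X n (n - 1)` is the sample of size `n`
    (X : (n : ℕ) → Fin n → Ω → EuclideanSpace ℝ (Fin d))
    (hlaw : ∀ (n : ℕ) (i : Fin n),
      HasLaw (X n i) (volume.withDensity fun x => ENNReal.ofReal (f x)) P)
    (α : ℕ → ℝ) (hAI : ∀ n : ℕ, 0 < n → IsAlmostIndependent (X n) P (α n))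
    (hα : ∀ β : ℝ, 1 < β → Summable fun n : ℕ => α n / ((n : ℝ) ^ β * Real.log n))
    (c : ℝ) (hc : (6 / (f₀ * unitBallVolume d)) ^ (1 / (d : ℝ)) < c) :
    (interior M = ∅ →
      ∀ᵐ ω ∂P, ∀ᶠ n : ℕ in atTop,
        |maxMinBoundaryDist (fun i => X n i ω) (ballRadius d c n) - R₁| ≤ 2 * ballRadius d c n) ∧
    ((interior M).Nonempty →
      ∃ C : ℝ, 0 < C ∧ ∀ᵐ ω ∂P, ∀ᶠ n : ℕ in atTop,
        C < |maxMinBoundaryDist (fun i => X n i ω) (ballRadius d c n) - R₁|) := by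
  have hc0 : 0 < c := (Real.rpow_nonneg
    (div_nonneg (by norm_num) (mul_nonneg hf₀.le (unitBallVolume_pos d).le)) _).trans_lt hc
  -- A thickening of the empty set is empty, whereas a probability measure here has nonempty
  -- support.
  have hne : M.Nonempty := by
    have := isProbabilityMeasure_of_hasLaw (hlaw 1 0)
    have h := Measure.nonempty_support (IsProbabilityMeasure.ne_zero
      (volume.withDensity fun x => ENNReal.ofReal (f x)))
    rw [hsupp] at h
    by_contra hM0
    rw [Set.not_nonempty_iff_eq_empty.1 hM0, Metric.cthickening_empty] at h
    exact Set.not_nonempty_empty h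
  have hmem : ∀ᵐ ω ∂P, ∀ n i, X n i ω ∈ Metric.cthickening R₁ M := hsupp ▸ ae_forall_mem_support hlaw
  have hρ := tendsto_ballRadius hd c
  obtain ⟨κ, hκ, hnet⟩ := exists_ae_eventually_net hd hM hR₁ hf hf_nonneg hf₀ hf_lower hlaw hAI hα hc
  have hcov : ∀ᵐ ω ∂P, ∀ᶠ n : ℕ in atTop, ∀ x ∈ Metric.cthickening R₁ M,
      ∃ i, dist x (X n i ω) < ballRadius d c n := by
    filter_upwards [hnet] with ω hω
    filter_upwards [hω, eventually_ge_atTop 2] with n hn hn2 x hx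
    obtain ⟨i, hi⟩ := hn x hx
    exact ⟨i, hi.trans_lt (mul_lt_of_lt_one_left (ballRadius_pos hc0 hn2) hκ)⟩
  constructor
  · intro hint
    have hreach' : ∀ᶠ n in atTop, ENNReal.ofReal (R₁ + ballRadius d c n) < reach M := by
      have h : Tendsto (fun n => ENNReal.ofReal (R₁ + ballRadius d c n)) atTop
          (𝓝 (ENNReal.ofReal (R₁ + 0))) := ENNReal.tendsto_ofReal (hρ.const_add R₁)
      rw [add_zero] at h
      exact h.eventually (gt_mem_nhds (hreach ▸ hR₁₀))
    filter_upwards [hmem, hcov] with ω hω1 hω2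
    filter_upwards [hω2, hreach', eventually_ge_atTop 2] with n h1 h2 hn
    exact abs_maxMinBoundaryDist_sub_le hd (by lia) hM hne hint hR₁ (ballRadius_pos hc0 hn)
      (hω1 n) h1 h2
  · rintro ⟨z, hz⟩
    obtain ⟨η, hη, hball⟩ := Metric.nhds_basis_closedBall.mem_iff.1 (mem_interior_iff_mem_nhds.1 hz)
    -- Once `ρ_n < η / 4`, the gain satisfies `η - 2ρ_n > η / 2`.
    refine ⟨η / 2, half_pos hη, ?_⟩
    filter_upwards [hcov] with ω hω
    filter_upwards [hω, eventually_ge_atTop 2, hρ.eventually (gt_mem_nhds hR₁),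
      hρ.eventually (gt_mem_nhds (show 0 < η / 4 by positivity))] with n h1 hn h2 h3
    have h := add_le_maxMinBoundaryDist hd (by lia) hη.le hball hR₁ (ballRadius_pos hc0 hn)
      h2.le h1
    exact lt_of_lt_of_le (by linarith) (le_abs_self _)
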